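/- Let $n,m\ge 1$, let $\alpha=\alpha_0<\alpha_1<\dots<\alpha_m=\beta$ be real numbers, let $A_1,\dots,A_m$ be invertible diagonalizable complex $n\times n$ matrices, put $A(x)=A_s$ for $\alpha_{s-1}<x\le\alpha_s$, and let $S,T$ be arbitrary complex $n\times n$ matrices. Let $L$ be the operator $Lf=Af'$ in $L^2((\alpha,\beta),\mathbb{C}^n)$ whose domain consists of all $f\in W^{1,2}((\alpha,\beta),\mathbb{C}^n)$ with $Sf(\alpha)+Tf(\beta)=0$. Put $$F(z)=\det\bigl(S+T\,U_m\cdots U_2U_1\bigr),\qquad U_s=e^{z(\alpha_s-\alpha_{s-1})A_s^{-1}},$$ and write $F(z)=\sum_{r=1}^R\delta_r e^{z\overline{\gamma_r}}$ with distinct $\gamma_r\in\mathbb{C}$ and non-zero $\delta_r\in\mathbb{C}$. Let $K$ be the convex hull of $\{\gamma_1,\dots,\gamma_R\}$. Assume that $R\ge 2$ and that every $\gamma_r$ is either a vertex of $K$ or an interior point of $K$ (the generic case). Theorem. Within the class of all such operators $L$ for which all zeros of $F$ are simple, the spectrum of $L$ determines $F$ up to an exponential factor, and hence the set of exponents $\gamma_r$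 up to a common additive constant, and so the polygon $K$ up to translation. That is, if $L$ and $\tilde L$ are two such operators (possibly with different $n$, $m$, intervals, coefficients and boundary conditions), if all zeros of $F$ and all zeros of $\tilde F$ are simple, and if $L$ and $\tilde L$ have the same spectrum, then there are $c,h\in\mathbb{C}$ with $c\ne 0$ such that $\tilde F(z)=c\,e^{hz}F(z)$ for all $z\in\mathbb{C}$, $\{\tilde\gamma_r\}=\{\gamma_r+\overline h\}$ and $\tilde K=K+\overline h$. -/

import Mathlib

open MeasureTheory Set
open scoped ComplexConjugate

noncomputable section

/-- The spectrum of a (possibly unbounded) operator `T` in a complex normed space: the set of `z`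
for which `T - z` has no everywhere defined bounded two-sided inverse. -/
def LinearPMap.unboundedSpectrum {H : Type*} [NormedAddCommGroup H] [NormedSpace ℂ H]
    (T : H →ₗ.[ℂ] H) : Set ℂ :=
  {z | ¬ ∃ B : H →L[ℂ] H,
    (∀ h : H, ∃ hB : B h ∈ T.domain, T ⟨B h, hB⟩ - z • B h = h) ∧
    (∀ f : T.domain, B (T f - z • (f : H)) = f)}

/-- `L²((a, b), ℂⁿ)`. -/
abbrev L2Interval (n : ℕ) (a b : ℝ) : Type :=
  Lp (EuclideanSpace ℂ (Fin n)) 2 (volume.restrict (Ioo a b))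

/-- `u` is (on `[a, b]`) the continuous representative of an element of `W^{1,2}((a, b), ℂⁿ)` whose
derivative is `g ∈ L²((a, b), ℂⁿ)`: it is the primitive of `g`. -/
def IsW12 {n : ℕ} {a b : ℝ} (u : ℝ → EuclideanSpace ℂ (Fin n)) (g : L2Interval n a b) : Prop :=
  ∀ x ∈ Icc a b, u x = u a + ∫ t in a..x, g t

theorem L2Interval.intervalIntegrable {n : ℕ} {a b : ℝ} (hab : a ≤ b) (g : L2Interval n a b) :
    IntervalIntegrable g volume a b := by
  have h1 : Integrable g (volume.restrict (Ioo a b)) :=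
    (Lp.memLp g).integrable (by norm_num)
  rw [intervalIntegrable_iff_integrableOn_Ioo_of_le hab]
  exact h1

theorem L2Interval.intervalIntegrable_left {n : ℕ} {a b x : ℝ} (hx : x ∈ Icc a b)
    (g : L2Interval n a b) : IntervalIntegrable g volume a x := by
  refine (L2Interval.intervalIntegrable (hx.1.trans hx.2) g).mono_set ?_
  rw [uIcc_of_le hx.1, uIcc_of_le (hx.1.trans hx.2)]
  exact Icc_subset_Icc_right hx.2

theorem IsW12.add {n : ℕ} {a b : ℝ} {u v : ℝ → EuclideanSpace ℂ (Fin n)}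
    {g h : L2Interval n a b} (hu : IsW12 u g) (hv : IsW12 v h) : IsW12 (u + v) (g + h) := by
  intro x hx
  have hab : a ≤ b := hx.1.trans hx.2
  have e : ∫ t in a..x, (g + h : L2Interval n a b) t = ∫ t in a..x, (g t + h t) := by
    apply intervalIntegral.integral_congr_ae_restrict
    have h0 := ae_restrict_of_ae_restrict_of_subset (Ioo_subset_Ioo_right hx.2)
      (Lp.coeFn_add g h)
    rw [uIoc_of_le hx.1, ← restrict_Ioo_eq_restrict_Ioc]
    exact h0
  rw [e, intervalIntegral.integral_add (g.intervalIntegrable_left hx)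
    (h.intervalIntegrable_left hx), Pi.add_apply, Pi.add_apply, hu x hx, hv x hx]
  abel

theorem IsW12.smul {n : ℕ} {a b : ℝ} {u : ℝ → EuclideanSpace ℂ (Fin n)}
    {g : L2Interval n a b} (c : ℂ) (hu : IsW12 u g) : IsW12 (c • u) (c • g) := by
  intro x hx
  have e : ∫ t in a..x, (c • g : L2Interval n a b) t = ∫ t in a..x, c • g t := by
    apply intervalIntegral.integral_congr_ae_restrict
    have h0 := ae_restrict_of_ae_restrict_of_subset (Ioo_subset_Ioo_right hx.2)
      (Lp.coeFn_smul c g)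
    rw [uIoc_of_le hx.1, ← restrict_Ioo_eq_restrict_Ioc]
    exact h0
  rw [e, intervalIntegral.integral_smul, Pi.smul_apply, Pi.smul_apply, hu x hx, smul_add]

theorem IsW12.ae_eq_zero {n : ℕ} {a b : ℝ} (hab : a < b) {u : ℝ → EuclideanSpace ℂ (Fin n)}
    {g : L2Interval n a b} (hu : IsW12 u g) (h0 : ∀ᵐ x ∂volume.restrict (Ioo a b), u x = 0) :
    ∀ᵐ x ∂volume.restrict (Ioo a b), g x = 0 := by
  have hint := g.intervalIntegrable hab.le
  have hcont : ContinuousOn (fun x => u a + ∫ t in a..x, g t) (Ioo a b) := by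
    have := intervalIntegral.continuousOn_primitive_interval'
      hint (left_mem_uIcc (a := a) (b := b))
    rw [uIcc_of_le hab.le] at this
    exact (continuousOn_const.add this).mono Ioo_subset_Icc_self
  have hzero : EqOn (fun x => u a + ∫ t in a..x, g t) (fun _ => 0) (Ioo a b) := by
    apply Measure.eqOn_open_of_ae_eq (μ := volume) _ isOpen_Ioo hcont continuousOn_const
    filter_upwards [h0, ae_restrict_mem measurableSet_Ioo] with x hx hxm
    rw [← hu x (Ioo_subset_Icc_self hxm), hx]
  have hder := hint.ae_hasDerivAt_integral
  rw [ae_restrict_iff' measurableSet_Ioo]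
  filter_upwards [hder] with x hx hxm
  have hxI : x ∈ uIcc a b := by
    rw [uIcc_of_le hab.le]; exact Ioo_subset_Icc_self hxm
  have h1 : HasDerivAt (fun y => u a + ∫ t in a..y, g t) (g x) x :=
    (hx hxI a left_mem_uIcc).const_add _
  have h2 : HasDerivAt (fun y => u a + ∫ t in a..y, g t) 0 x := by
    refine (hasDerivAt_const x (0 : EuclideanSpace ℂ (Fin n))).congr_of_eventuallyEq ?_
    filter_upwards [isOpen_Ioo.mem_nhds hxm] with y hy using hzero hy
  exact h1.unique h2

/-- Data of a first order system `L f = A f'` in `L²((α, β), ℂⁿ)` with a piecewise constant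
coefficient `A` and boundary conditions `S f(α) + T f(β) = 0`. -/
structure EllipticSystem (n m : ℕ) where
  /-- there is at least one piece -/
  m_pos : 0 < m
  /-- the points `α = α₀ < α₁ < ⋯ < αₘ = β` -/
  node : Fin (m + 1) → ℝ
  node_strictMono : StrictMono node
  /-- the value of the coefficient on the `s`-th piece `(αₛ₋₁, αₛ]`, with `s` counted from `0` -/
  A : Fin m → Matrix (Fin n) (Fin n) ℂ
  A_invertible : ∀ s, IsUnit (A s)
  A_diagonalizable : ∀ s, ∃ (V : Matrix (Fin n) (Fin n) ℂ) (d : Fin n → ℂ),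
    IsUnit V ∧ A s = V * Matrix.diagonal d * V⁻¹
  /-- the boundary matrix at `α` -/
  S : Matrix (Fin n) (Fin n) ℂ
  /-- the boundary matrix at `β` -/
  T : Matrix (Fin n) (Fin n) ℂ

namespace EllipticSystem

variable {n m : ℕ} (P : EllipticSystem n m)

/-- The left end-point `α`. -/
def left : ℝ := P.node 0

/-- The right end-point `β`. -/
def right : ℝ := P.node (Fin.last m)

theorem left_lt_right : P.left < P.right := by
  apply P.node_strictMono
  rw [Fin.lt_def]
  simpa using P.m_pos

/-- The piecewise constant coefficient `A(x)`, with `A(x) = Aₛ` for `αₛ₋₁ < x ≤ αₛ`. -/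
def coeff (x : ℝ) : Matrix (Fin n) (Fin n) ℂ :=
  ∑ s : Fin m, (Ioc (P.node s.castSucc) (P.node s.succ)).indicator (fun _ => P.A s) x

/-- The graph of `L`: the pairs `(f, A f')` with `f ∈ W^{1,2}` and `S f(α) + T f(β) = 0`, where
the boundary values are those of the continuous representative `u` of `f`. -/
def graph : Submodule ℂ (L2Interval n P.left P.right × L2Interval n P.left P.right) where
  carrier := {p | ∃ (u : ℝ → EuclideanSpace ℂ (Fin n)) (g : L2Interval n P.left P.right),
    IsW12 u g ∧
    (∀ᵐ x ∂volume.restrict (Ioo P.left P.right), p.1 x = u x) ∧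
    (∀ᵐ x ∂volume.restrict (Ioo P.left P.right), p.2 x = (P.coeff x).toEuclideanLin (g x)) ∧
    P.S.toEuclideanLin (u P.left) + P.T.toEuclideanLin (u P.right) = 0}
  zero_mem' := by
    have hz := Lp.coeFn_zero (EuclideanSpace ℂ (Fin n)) 2 (volume.restrict (Ioo P.left P.right))
    refine ⟨0, 0, ?_, ?_, ?_, by simp⟩
    · have : IsW12 ((0 : ℂ) • (fun x => ∫ t in P.left..x, (0 : L2Interval n P.left P.right) t))
          ((0 : ℂ) • (0 : L2Interval n P.left P.right)) := IsW12.smul 0 (fun x _ => by simp)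
      simpa using this
    · filter_upwards [hz] with x hx
      simpa using hx
    · filter_upwards [hz] with x hx
      simp only [Prod.snd_zero, hx, Pi.zero_apply, map_zero]
  add_mem' := by
    rintro ⟨f₁, k₁⟩ ⟨f₂, k₂⟩ ⟨u₁, g₁, hw₁, hf₁, hk₁, hb₁⟩ ⟨u₂, g₂, hw₂, hf₂, hk₂, hb₂⟩
    refine ⟨u₁ + u₂, g₁ + g₂, hw₁.add hw₂, ?_, ?_, ?_⟩
    · filter_upwards [hf₁, hf₂, Lp.coeFn_add f₁ f₂] with x h₁ h₂ h
      simp only [Prod.mk_add_mk, h, Pi.add_apply, h₁, h₂]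
    · filter_upwards [hk₁, hk₂, Lp.coeFn_add k₁ k₂, Lp.coeFn_add g₁ g₂] with x h₁ h₂ h h'
      simp only [Prod.mk_add_mk, h, h', Pi.add_apply, h₁, h₂, map_add]
    · simp only [Pi.add_apply, map_add]
      rw [add_add_add_comm, hb₁, hb₂, add_zero]
  smul_mem' := by
    rintro c ⟨f, k⟩ ⟨u, g, hw, hf, hk, hb⟩
    refine ⟨c • u, c • g, hw.smul c, ?_, ?_, ?_⟩
    · filter_upwards [hf, Lp.coeFn_smul c f] with x h₁ h
      simp only [Prod.smul_mk, h, Pi.smul_apply, h₁]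
    · filter_upwards [hk, Lp.coeFn_smul c k, Lp.coeFn_smul c g] with x h₁ h h'
      simp only [Prod.smul_mk, h, h', Pi.smul_apply, h₁, map_smul]
    · simp only [Pi.smul_apply, map_smul]
      rw [← smul_add, hb, smul_zero]

theorem graph_singleValued (p : L2Interval n P.left P.right × L2Interval n P.left P.right)
    (hp : p ∈ P.graph) (h0 : p.1 = 0) : p.2 = 0 := by
  obtain ⟨u, g, hw, hf, hk, -⟩ := hp
  have hu : ∀ᵐ x ∂volume.restrict (Ioo P.left P.right), u x = 0 := by
    rw [h0] at hf
    filter_upwards [hf, Lp.coeFn_zero (EuclideanSpace ℂ (Fin n)) 2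
      (volume.restrict (Ioo P.left P.right))] with x h₁ h₂
    rw [← h₁, h₂, Pi.zero_apply]
  have hg := hw.ae_eq_zero P.left_lt_right hu
  rw [Lp.eq_zero_iff_ae_eq_zero]
  filter_upwards [hk, hg] with x h₁ h₂
  rw [h₁, h₂, map_zero, Pi.zero_apply]

/-- The operator `L f = A f'` in `L²((α, β), ℂⁿ)`, with domain the set of all `f ∈ W^{1,2}` such
that `S f(α) + T f(β) = 0`. -/
def operator : L2Interval n P.left P.right →ₗ.[ℂ] L2Interval n P.left P.right :=
  P.graph.toLinearPMap

theorem operator_graph : P.operator.graph = P.graph :=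
  Submodule.toLinearPMap_graph_eq _ P.graph_singleValued

/-- The transfer matrix `U(z, β) = Uₘ ⋯ U₂ U₁` with `Uₛ = exp (z (αₛ - αₛ₋₁) Aₛ⁻¹)`. -/
def transfer (z : ℂ) : Matrix (Fin n) (Fin n) ℂ :=
  (List.ofFn fun s : Fin m =>
    NormedSpace.exp ((z * ((P.node s.succ - P.node s.castSucc : ℝ) : ℂ)) • (P.A s)⁻¹)).reverse.prod

/-- The entire function `F(z) = det (S + T U(z, β))`. -/
def F (z : ℂ) : ℂ := (P.S + P.T * P.transfer z).det

end EllipticSystem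

/-- `F(z) = ∑ᵣ δᵣ exp (z * conj γᵣ)` with at least two terms, distinct `γᵣ`, non-zero `δᵣ`, in the
generic case: with `K` the convex hull of the `γᵣ`, each `γᵣ` is a vertex of `K` or lies in the
interior of `K`. -/
structure IsGenericExpansion (F : ℂ → ℂ) {R : ℕ} (γ δ : Fin R → ℂ) : Prop where
  two_le : 2 ≤ R
  injective : Function.Injective γ
  ne_zero : ∀ r, δ r ≠ 0
  expansion : ∀ z, F z = ∑ r, δ r * Complex.exp (z * conj (γ r))
  generic : ∀ r, γ r ∈ (convexHull ℝ (range γ)).extremePoints ℝ ∨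
    γ r ∈ interior (convexHull ℝ (range γ))

end

/-! The spectrum of `L` is the zero set of `F`. Variation of constants writes every solution of `A
u' - z u = h` as `U(x) (c + w(x))` with `U` the propagator, `c` the initial value and `w` an
integral of `h`. The boundary condition then becomes the linear equation `(S + T U(β)) c = -T U(β)
w(β)`. If `F z ≠ 0`, it determines `c`, with a bound, and `L - z` has a bounded inverse; if `F z =
0`, a kernel vector is the initial value of an eigenfunction. This is
`EllipticSystem.unboundedSpectrum_operator`.

Thus equal spectra and simple zeros make `q = F₂ / F₁` entire and zero-free. Both functions are of
exponential type, so their Nevanlinna characteristics grow at most linearly. Jensen's formula in the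
form `T(1/f) = T(f) + O(1)` passes this on to `q`. Harnack's inequality turns the resulting mean
bound into a pointwise bound on `log ‖q‖`, and with `q = exp G`, Borel–Carathéodory and Liouville
make `G` affine. This is `EntireFunction.eq_const_mul_exp_mul_of_zeros_eq`.

The exponents are then compared by the linear independence of exponentials. The factor `exp (h z)`
shifts each `conj γ` by `h`, hence each `γ` by `conj h`, and the convex hull moves with them. -/

noncomputable section

/-! ### Entire functions of exponential type with common simple zeros -/

namespace EntireFunction

open Real ValueDistribution Metric

/-- An entire function of exponential type has a characteristic of at most linear growth. -/
theorem characteristic_top_le {f : ℂ → ℂ} (hf : Differentiable ℂ f) {C : ℝ}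
    (hC : ∀ z, log⁺ ‖f z‖ ≤ C * (1 + ‖z‖)) {r : ℝ} (hr : 0 ≤ r) :
    characteristic f ⊤ r ≤ C * (1 + r) := by
  have ha : AnalyticOnNhd ℂ f univ := fun z _ => hf.analyticAt z
  have h0 : logCounting f ⊤ = 0 := by
    rw [logCounting_top, negPart_eq_zero.2 (MeromorphicOn.AnalyticOnNhd.divisor_nonneg ha),
      map_zero]
  rw [characteristic, h0, add_zero, proximity_top]
  apply circleAverage_mono_on_of_le_circle
  · exact MeromorphicOn.circleIntegrable_posLog_norm fun z _ => (ha z (mem_univ z)).meromorphicAt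
  · intro z hz
    have : ‖z‖ = r := by simpa [abs_of_nonneg hr] using hz
    simpa [this] using hC z


/-- Harnack's inequality for `log ‖q‖`, with the proximity function as an upper bound. -/
theorem log_norm_le_three_mul_proximity {q : ℂ → ℂ} (hq : Differentiable ℂ q)
    (h0 : ∀ z, q z ≠ 0) {r : ℝ} (hr : 0 < r) {w : ℂ} (hw : ‖w‖ ≤ r / 2) :
    log ‖q w‖ ≤ 3 * proximity q ⊤ r := by
  have hharm : InnerProductSpace.HarmonicOnNhd (fun z => log ‖q z‖) (closedBall 0 r) :=
    fun z _ => (hq.analyticAt z).harmonicAt_log_norm (h0 z)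
  have hwb : w ∈ ball (0 : ℂ) r := by
    rw [mem_ball_zero_iff]; linarith
  -- The Poisson formula: `log ‖q w‖` is a circle average with the real part of the Herglotz–Riesz
  -- kernel as weight.
  have hP := hharm.circleAverage_re_herglotzRieszKernel_smul hwb
  have hlogc : Continuous fun z => log ‖q z‖ :=
    hq.continuous.norm.log fun z => norm_ne_zero_iff.2 (h0 z)
  have hposc : Continuous fun z => log⁺ ‖q z‖ := continuous_posLog.comp hq.continuous.norm
  rw [← hP, proximity_top, ← smul_eq_mul (3 : ℝ), ← circleAverage_fun_smul]
  refine circleAverage_mono ?_ ?_ ?_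
  · apply ContinuousOn.circleIntegrable'
    refine ContinuousOn.smul (Complex.continuous_re.comp_continuousOn ?_) hlogc.continuousOn
    exact continuousOn_herglotzRieszKernel_sphere hwb
  · exact (hposc.const_smul (3 : ℝ)).continuousOn.circleIntegrable'
  · intro z hz
    rw [abs_of_pos hr] at hz
    have hden : 0 < r - ‖w‖ := by linarith
    have h1 := re_herglotzRieszKernel_le hz hwb
    have h2 := le_re_herglotzRieszKernel hz hwb
    rw [sub_zero] at h1 h2
    -- The Harnack factor at `‖w‖ ≤ r / 2`, which is the source of the constant `3`.
    have h3 : (r + ‖w‖) / (r - ‖w‖) ≤ 3 := by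
      rw [div_le_iff₀ hden]; linarith only [hw]
    have h4 : 0 ≤ (r - ‖w‖) / (r + ‖w‖) := div_nonneg hden.le (by positivity)
    have h5 : log ‖q z‖ ≤ log⁺ ‖q z‖ := le_max_right _ _
    have h6 : 0 ≤ log⁺ ‖q z‖ := posLog_nonneg
    simp only [Pi.smul_apply', Function.comp_apply, smul_eq_mul, herglotzRieszKernel_def, sub_zero]
    simp only [sub_zero] at h1 h2
    calc _ ≤ ((z + w) / (z - w)).re * log⁺ ‖q z‖ :=
          mul_le_mul_of_nonneg_left h5 (h4.trans h2)
      _ ≤ 3 * log⁺ ‖q z‖ := mul_le_mul_of_nonneg_right (h1.trans h3) h6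

/-- A zero-free entire function has an entire logarithm. -/
theorem exists_eq_exp {q : ℂ → ℂ} (hq : Differentiable ℂ q) (h0 : ∀ z, q z ≠ 0) :
    ∃ G : ℂ → ℂ, Differentiable ℂ G ∧ ∀ z, q z = Complex.exp (G z) := by
  -- A primitive of the logarithmic derivative is a logarithm up to an additive constant, here `b`.
  have hd : Differentiable ℂ (fun z => deriv q z / q z) :=
    hq.deriv.div hq h0
  obtain ⟨G, hG⟩ := hd.isExactOn_univ
  have hGd : Differentiable ℂ G := fun z => (hG z (mem_univ z)).differentiableAt
  obtain ⟨b, hb⟩ : ∃ b, Complex.exp b = q 0 * Complex.exp (-G 0) :=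
    ⟨_, Complex.exp_log (mul_ne_zero (h0 0) (Complex.exp_ne_zero _))⟩
  refine ⟨fun z => G z + b, hGd.add_const b, fun z => ?_⟩
  have hder : ∀ z, HasDerivAt (fun z => q z * Complex.exp (-G z)) 0 z := fun z => by
    have := (hq z).hasDerivAt.mul (hG z (mem_univ z)).neg.cexp
    convert! this using 1
    field_simp [h0 z]
    ring
  have hconst := is_const_of_deriv_eq_zero (fun z => (hder z).differentiableAt)
    (fun z => (hder z).deriv) z 0
  rw [Complex.exp_add, hb, ← hconst, mul_left_comm, ← Complex.exp_add]
  simp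

/-- An entire function whose real part grows at most linearly is affine. -/
theorem exists_affine_of_re_le {G : ℂ → ℂ} (hG : Differentiable ℂ G) {C : ℝ}
    (hC : ∀ z, (G z).re ≤ C * (1 + ‖z‖)) : ∃ h b : ℂ, ∀ z, G z = h * z + b := by
  set D := max C 1
  have hD : 0 < D := lt_of_lt_of_le one_pos (le_max_right _ _)
  have hre : ∀ z, (G z).re ≤ D * (1 + ‖z‖) := fun z =>
    (hC z).trans (mul_le_mul_of_nonneg_right (le_max_left _ _) (by positivity))
  have hlin : ∀ z, ‖G z‖ ≤ (6 * D + 3 * ‖G 0‖) * (1 + ‖z‖) := by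
    intro z
    have hz := norm_nonneg z
    -- The disc of radius `2‖z‖ + 2` leaves a distance `‖z‖ + 2` to the boundary; on it `1 + ‖w‖ ≤ 3
    -- + 2‖z‖`.
    have h := Complex.borelCaratheodory (f := G) (M := D * (3 + 2 * ‖z‖)) (R := 2 * ‖z‖ + 2)
      (z := z) (by positivity) hG.differentiableOn
      (fun w hw => (hre w).trans
        (mul_le_mul_of_nonneg_left (by linarith [mem_ball_zero_iff.1 hw]) hD.le)) (by positivity)
      (mem_ball_zero_iff.2 (by linarith))
    refine h.trans ?_
    clear h
    have hden : 0 < 2 * ‖z‖ + 2 - ‖z‖ := by linarith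
    rw [← add_div, div_le_iff₀ hden]
    have := norm_nonneg (G 0)
    have e1 : 0 ≤ D * ‖z‖ := by positivity
    have e2 : 0 ≤ D * ‖z‖ ^ 2 := by positivity
    have e3 : 0 ≤ ‖G 0‖ * ‖z‖ := by positivity
    have e4 : 0 ≤ ‖G 0‖ * ‖z‖ ^ 2 := by positivity
    nlinarith
  set E := 6 * D + 3 * ‖G 0‖
  have hE : 0 < E := by positivity
  have hder : ∀ z, ‖deriv G z‖ ≤ 2 * E := by
    intro z
    -- Cauchy's estimate on a circle whose radius is comparable to `1 + ‖z‖` cancels the linear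
    -- growth, so that Liouville applies to `deriv G`.
    have h := Complex.norm_deriv_le_of_forall_mem_sphere_norm_le (c := z) (R := 1 + ‖z‖)
      (C := 2 * E * (1 + ‖z‖)) (f := G) (by positivity) hG.diffContOnCl (fun w hw => by
        have h1 : ‖w - z‖ = 1 + ‖z‖ := by simpa [dist_eq_norm] using hw
        have h2 : ‖w‖ ≤ ‖w - z‖ + ‖z‖ := norm_le_norm_sub_add _ _
        refine (hlin w).trans ?_
        rw [mul_comm 2 E, mul_assoc]
        gcongr
        linarith)
    rwa [mul_div_assoc, div_self (by positivity), mul_one] at h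
  obtain ⟨h, hh⟩ := hG.deriv.exists_const_forall_eq_of_bounded
    (isBounded_iff_forall_norm_le.2 ⟨2 * E, by rintro _ ⟨z, rfl⟩; exact hder z⟩)
  refine ⟨h, G 0, fun z => ?_⟩
  have hd : ∀ z, HasDerivAt (fun z => G z - h * z) 0 z := fun z => by
    have := (hG z).hasDerivAt.sub ((hasDerivAt_id z).const_mul h)
    convert! this using 1
    simp [hh z]
  have := is_const_of_deriv_eq_zero (fun z => (hd z).differentiableAt) (fun z => (hd z).deriv) z 0
  simp only [mul_zero, sub_zero] at this
  rw [← this]; ring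

/-- The quotient of two entire functions with the same simple zeros is entire and zero-free. -/
theorem exists_quotient {f g : ℂ → ℂ} (hf : Differentiable ℂ f) (hg : Differentiable ℂ g)
    (hfs : ∀ z, f z = 0 → deriv f z ≠ 0) (hgs : ∀ z, g z = 0 → deriv g z ≠ 0)
    (hfg : ∀ z, f z = 0 ↔ g z = 0) :
    ∃ q : ℂ → ℂ, Differentiable ℂ q ∧ (∀ z, q z ≠ 0) ∧ ∀ z, g z = q z * f z := by
  classical
  -- At a common zero the removable singularity gets the ratio of the derivatives. Near it, `f` and
  -- `g` are both `w - z` times their `dslope`, and the quotient of the slopes is analytic.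
  refine ⟨fun z => if f z = 0 then deriv g z / deriv f z else g z / f z, ?_, ?_, ?_⟩
  · intro z
    by_cases hz : f z = 0
    · have hdf : Differentiable ℂ (dslope f z) := differentiableOn_univ.1
        ((Complex.differentiableOn_dslope Filter.univ_mem).2 hf.differentiableOn)
      have hdg : Differentiable ℂ (dslope g z) := differentiableOn_univ.1
        ((Complex.differentiableOn_dslope Filter.univ_mem).2 hg.differentiableOn)
      have hne : dslope f z z ≠ 0 := by rw [dslope_same]; exact hfs z hz
      refine ((hdg z).div (hdf z) hne).congr_of_eventuallyEq ?_
      filter_upwards [hdf.continuous.continuousAt.eventually_ne hne] with w hw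
      by_cases hwz : w = z
      · subst hwz
        simp [hz]
      · have hf1 : f w = (w - z) * dslope f z w := by
          simpa [hz] using (sub_smul_dslope f z w).symm
        have hg1 : g w = (w - z) * dslope g z w := by
          simpa [(hfg z).1 hz] using (sub_smul_dslope g z w).symm
        have hwz' : w - z ≠ 0 := sub_ne_zero.2 hwz
        have hfw : f w ≠ 0 := by rw [hf1]; exact mul_ne_zero hwz' hw
        simp only [hfw, if_false, Pi.div_apply]
        rw [hf1, hg1, mul_div_mul_left _ _ hwz']
    · refine ((hg z).div (hf z) hz).congr_of_eventuallyEq ?_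
      filter_upwards [hf.continuous.continuousAt.eventually_ne hz] with w hw
      simp [hw]
  · intro z
    by_cases hz : f z = 0
    · simpa [hz] using ⟨hgs z ((hfg z).1 hz), hfs z hz⟩
    · simpa [hz] using fun h => hz ((hfg z).2 h)
  · intro z
    by_cases hz : f z = 0
    · simp [hz, (hfg z).1 hz]
    · simp [hz]

/-- If `f` vanished near a point, its derivative would vanish there too, against simplicity. -/
theorem meromorphicOrderAt_ne_top {f : ℂ → ℂ} (hf : Differentiable ℂ f)
    (hfs : ∀ z, f z = 0 → deriv f z ≠ 0) (z : ℂ) : meromorphicOrderAt f z ≠ ⊤ := by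
  rw [(hf.analyticAt z).meromorphicOrderAt_eq, ne_eq, ENat.map_eq_top_iff,
    analyticOrderAt_eq_top]
  intro h
  refine hfs z h.self_of_nhds ?_
  rw [Filter.EventuallyEq.deriv_eq (f := fun _ => (0 : ℂ)) h]
  simp

/-- Two entire functions of exponential type with the same zeros, all of them simple, agree up to
an exponential factor. -/
theorem eq_const_mul_exp_mul_of_zeros_eq {f g : ℂ → ℂ} (hf : Differentiable ℂ f)
    (hg : Differentiable ℂ g) {Cf Cg : ℝ} (hCf : ∀ z, log⁺ ‖f z‖ ≤ Cf * (1 + ‖z‖))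
    (hCg : ∀ z, log⁺ ‖g z‖ ≤ Cg * (1 + ‖z‖))
    (hfs : ∀ z, f z = 0 → deriv f z ≠ 0) (hgs : ∀ z, g z = 0 → deriv g z ≠ 0)
    (hfg : ∀ z, f z = 0 ↔ g z = 0) :
    ∃ c h : ℂ, c ≠ 0 ∧ ∀ z, g z = c * Complex.exp (h * z) * f z := by
  obtain ⟨q, hq, hq0, hgq⟩ := exists_quotient hf hg hfs hgs hfg
  have hfm : Meromorphic f := fun z => (hf.analyticAt z).meromorphicAt
  have hgm : Meromorphic g := fun z => (hg.analyticAt z).meromorphicAt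
  obtain ⟨x, hx⟩ : ∃ x, f x ≠ 0 := by
    by_contra! h
    refine hfs 0 (h 0) ?_
    rw [funext h]
    simp
  -- At the zeros of `f` the right-hand side is `0` because `0⁻¹ = 0`; the characteristic does not
  -- see this discrete set.
  have hqc : q =ᶠ[Filter.codiscrete ℂ] g * f⁻¹ := by
    filter_upwards [AnalyticOnNhd.preimage_zero_mem_codiscrete (fun z _ => hf.analyticAt z) hx]
      with z hz
    have : f z ≠ 0 := hz
    simp [hgq z, this]
  obtain ⟨K, hK⟩ : ∃ K : ℝ, ∀ r, characteristic f⁻¹ ⊤ r ≤ characteristic f ⊤ r + K :=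
    ⟨_, fun r => by
      have := (abs_le.1 (characteristic_sub_characteristic_inv_le hfm (R := r))).1
      linarith⟩
  set D := Cf + Cg + |K| with hD
  have hprox : ∀ r, 1 ≤ r → proximity q ⊤ r ≤ D * (1 + r) := by
    intro r hr
    have hr0 : 0 ≤ r := by linarith
    calc proximity q ⊤ r ≤ characteristic q ⊤ r := le_add_of_nonneg_right (logCounting_nonneg hr)
      _ = characteristic (g * f⁻¹) ⊤ r := characteristic_congr_codiscrete hqc (by linarith)
      _ ≤ characteristic g ⊤ r + characteristic f⁻¹ ⊤ r :=
          characteristic_mul_top_le hr hgm (meromorphicOrderAt_ne_top hg hgs) hfm.inv fun z => by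
            rw [meromorphicOrderAt_inv]
            simpa using meromorphicOrderAt_ne_top hf hfs z
      _ ≤ Cg * (1 + r) + (Cf * (1 + r) + |K| * (1 + r)) := by
          refine add_le_add (characteristic_top_le hg hCg hr0) ((hK r).trans
            (add_le_add (characteristic_top_le hf hCf hr0) ?_))
          nlinarith [le_abs_self K, abs_nonneg K]
      _ = _ := by rw [hD]; ring
  obtain ⟨G, hG, hqG⟩ := exists_eq_exp hq hq0
  -- The Harnack factor `3` times the bound `2 |D| (1 + ‖z‖)` at radius `2‖z‖ + 1` gives `6 |D|`.
  obtain ⟨h, b, hhb⟩ := exists_affine_of_re_le (C := 6 * |D|) hG fun z => by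
    have h1 := log_norm_le_three_mul_proximity hq hq0 (r := 2 * ‖z‖ + 1) (w := z)
      (by positivity) (by linarith)
    have h2 := hprox (2 * ‖z‖ + 1) (by linarith [norm_nonneg z])
    rw [hqG, Complex.norm_exp, log_exp] at h1
    have h3 : D * (1 + (2 * ‖z‖ + 1)) ≤ |D| * (2 * (1 + ‖z‖)) := by
      rw [show 1 + (2 * ‖z‖ + 1) = 2 * (1 + ‖z‖) by ring]
      exact mul_le_mul_of_nonneg_right (le_abs_self _) (by positivity)
    have h4 : 0 ≤ |D| * (1 + ‖z‖) := by positivity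
    nlinarith
  refine ⟨Complex.exp b, h, Complex.exp_ne_zero b, fun z => ?_⟩
  rw [hgq, hqG, hhb, add_comm, Complex.exp_add]

/-! ### Exponential sums -/

/-- Exponential sums are of exponential type. -/
theorem exists_posLog_norm_sum_exp_le {R : ℕ} (δ a : Fin R → ℂ) :
    ∃ C : ℝ, ∀ z, log⁺ ‖∑ r, δ r * Complex.exp (z * a r)‖ ≤ C * (1 + ‖z‖) := by
  refine ⟨log R + ∑ r, (log⁺ ‖δ r‖ + ‖a r‖), fun z => ?_⟩
  refine (posLog_norm_sum_le _ _).trans ?_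
  rw [Finset.card_univ, Fintype.card_fin, add_mul]
  have hz := norm_nonneg z
  refine add_le_add (le_mul_of_one_le_right (log_natCast_nonneg R) (by linarith)) ?_
  rw [Finset.sum_mul]
  refine Finset.sum_le_sum fun r _ => ?_
  rw [norm_mul]
  refine posLog_mul.trans ?_
  have h1 : log⁺ ‖Complex.exp (z * a r)‖ ≤ ‖a r‖ * ‖z‖ := by
    rw [Complex.norm_exp, posLog_apply, log_exp]
    refine max_le (by positivity) ((Complex.re_le_norm _).trans ?_)
    rw [norm_mul, mul_comm]
  have h2 : 0 ≤ log⁺ ‖δ r‖ := posLog_nonneg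
  nlinarith [norm_nonneg (a r), mul_nonneg h2 hz]

/-- Exponentials with distinct exponents are linearly independent. -/
theorem linearIndependent_exp_mul :
    LinearIndependent ℂ fun a : ℂ => fun z : ℂ => Complex.exp (z * a) := by
  -- Each exponential is a character of the additive group of `ℂ`, so Dedekind's independence of
  -- characters applies; the derivative at `0` recovers the exponent.
  let φ : ℂ → (Multiplicative ℂ →* ℂ) := fun a =>
    { toFun := fun z => Complex.exp (z.toAdd * a)
      map_one' := by simp
      map_mul' := fun x y => by simp [add_mul, Complex.exp_add] }
  have hφ : Function.Injective φ := by
    intro a b hab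
    have h : (fun z : ℂ => Complex.exp (z * a)) = fun z : ℂ => Complex.exp (z * b) :=
      funext fun z => DFunLike.congr_fun hab (Multiplicative.ofAdd z)
    have hd : ∀ a : ℂ, HasDerivAt (fun z : ℂ => Complex.exp (z * a)) a 0 := fun a => by
      simpa using ((hasDerivAt_id (0 : ℂ)).mul_const a).cexp
    exact (hd a).unique (h ▸ hd b)
  exact (linearIndependent_monoidHom (Multiplicative ℂ) ℂ).comp φ hφ

/-- The exponents of an exponential sum with distinct exponents and non-zero coefficients are
determined by the sum. -/
theorem range_eq_of_sum_exp_eq {R₁ R₂ : ℕ} {a δ : Fin R₁ → ℂ} {b ε : Fin R₂ → ℂ}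
    (ha : Function.Injective a) (hb : Function.Injective b) (hδ : ∀ r, δ r ≠ 0)
    (hε : ∀ r, ε r ≠ 0)
    (h : ∀ z, ∑ r, δ r * Complex.exp (z * a r) = ∑ r, ε r * Complex.exp (z * b r)) :
    range a = range b := by
  classical
  let x : ℂ →₀ ℂ := (Finsupp.equivFunOnFinite.symm δ).mapDomain a
  let y : ℂ →₀ ℂ := (Finsupp.equivFunOnFinite.symm ε).mapDomain b
  have hxy : x = y := by
    apply linearIndependent_exp_mul
    ext z
    simp only [x, y, Finsupp.linearCombination_mapDomain]
    simpa [Finsupp.linearCombination_apply, Finsupp.sum_fintype, Finset.sum_apply] using h z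
  have key : ∀ {R : ℕ} {c η : Fin R → ℂ}, Function.Injective c → (∀ r, η r ≠ 0) →
      ∀ w, (Finsupp.equivFunOnFinite.symm η).mapDomain c w ≠ 0 ↔ w ∈ range c := by
    intro R c η hc hη w
    constructor
    · intro hw
      by_contra hr
      exact hw (Finsupp.mapDomain_of_notMem_range _ _ hr)
    · rintro ⟨r, rfl⟩
      rw [Finsupp.mapDomain_apply hc]
      exact hη r
  ext w
  rw [← key ha hδ w, ← key hb hε w]
  exact iff_of_eq (congrArg (fun x : ℂ →₀ ℂ => x w ≠ 0) hxy)

end EntireFunction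

/-! ### Primitives of integrable functions and the Leibniz rule -/

/-- `u` is a primitive on `[a, b]` of the integrable function `g`. -/
def IsPrimitiveOn {E : Type*} [NormedAddCommGroup E] [NormedSpace ℝ E] (a b : ℝ) (u g : ℝ → E) :
    Prop :=
  IntervalIntegrable g volume a b ∧ ∀ x ∈ Icc a b, u x = u a + ∫ t in a..x, g t

theorem IntervalIntegrable.of_mem_Icc {E : Type*} [NormedAddCommGroup E] {a b : ℝ} {g : ℝ → E}
    (hg : IntervalIntegrable g volume a b) {x y : ℝ} (hx : x ∈ Icc a b) (hy : y ∈ Icc a b) :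
    IntervalIntegrable g volume x y := by
  refine hg.mono_set (uIcc_subset_uIcc ?_ ?_) <;> rw [uIcc_of_le (hx.1.trans hx.2)] <;> assumption

namespace IsPrimitiveOn

variable {E F G : Type*} [NormedAddCommGroup E] [NormedSpace ℝ E] [NormedAddCommGroup F]
  [NormedSpace ℝ F] [NormedAddCommGroup G] [NormedSpace ℝ G] {a b : ℝ}

theorem continuousOn_primitive (hab : a ≤ b) {g : ℝ → E} (hg : IntervalIntegrable g volume a b)
    (c : E) : ContinuousOn (fun x => c + ∫ t in a..x, g t) (Icc a b) := by
  have := intervalIntegral.continuousOn_primitive_interval' hg (left_mem_uIcc (a := a) (b := b))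
  rw [uIcc_of_le hab] at this
  exact continuousOn_const.add this

theorem continuousOn (hab : a ≤ b) {u g : ℝ → E} (h : IsPrimitiveOn a b u g) :
    ContinuousOn u (Icc a b) :=
  (continuousOn_primitive hab h.1 (u a)).congr h.2

theorem sub_eq {u g : ℝ → E} (h : IsPrimitiveOn a b u g) {x y : ℝ} (hx : x ∈ Icc a b)
    (hy : y ∈ Icc a b) : u y - u x = ∫ t in x..y, g t := by
  have ha : a ∈ Icc a b := left_mem_Icc.2 (hx.1.trans hx.2)
  rw [h.2 x hx, h.2 y hy, add_sub_add_left_eq_sub, intervalIntegral.integral_interval_sub_left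
    (h.1.of_mem_Icc ha hy) (h.1.of_mem_Icc ha hx)]

/-- A function on an interval whose increments are dominated by the integral of an integrable
function, and whose derivative vanishes almost everywhere, is constant. -/
theorem eq_of_ae_hasDerivAt_zero (hab : a ≤ b) {f : ℝ → E} {N : ℝ → ℝ}
    (hN : IntervalIntegrable N volume a b)
    (hfN : ∀ x ∈ Icc a b, ∀ y ∈ Icc a b, x ≤ y → ‖f y - f x‖ ≤ ∫ t in x..y, N t)
    (hf : ∀ᵐ x, x ∈ uIcc a b → HasDerivAt f 0 x) : ∀ x ∈ Icc a b, f x = f a := by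
  have hac : AbsolutelyContinuousOnInterval f a b := by
    have hNac := hN.absolutelyContinuousOnInterval_intervalIntegral (left_mem_uIcc (a := a) (b := b))
    rw [absolutelyContinuousOnInterval_iff] at hNac ⊢
    intro ε hε
    obtain ⟨δ, hδ, h⟩ := hNac ε hε
    refine ⟨δ, hδ, fun I hI hlt => lt_of_le_of_lt (Finset.sum_le_sum fun i hi => ?_) (h I hI hlt)⟩
    have hmem := hI.1 i hi
    rw [uIcc_of_le hab] at hmem
    have key : ∀ x ∈ Icc a b, ∀ y ∈ Icc a b, x ≤ y →
        dist (f x) (f y) ≤ dist (∫ v in a..x, N v) (∫ v in a..y, N v) := by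
      intro x hx y hy hxy
      rw [dist_comm, dist_eq_norm, dist_comm, dist_eq_norm,
        intervalIntegral.integral_interval_sub_left
          (IntervalIntegrable.of_mem_Icc hN (left_mem_Icc.2 hab) hy)
          (IntervalIntegrable.of_mem_Icc hN (left_mem_Icc.2 hab) hx)]
      exact (hfN x hx y hy hxy).trans (le_abs_self _)
    rcases le_total (I.2 i).1 (I.2 i).2 with hle | hle
    · exact key _ hmem.1 _ hmem.2 hle
    · rw [dist_comm, dist_comm (∫ v in a..(I.2 i).1, N v)]
      exact key _ hmem.2 _ hmem.1 hle
  obtain ⟨C, hC⟩ := hac.const_of_ae_hasDerivAt_zero hf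
  rw [uIcc_of_le hab] at hC
  intro x hx
  rw [hC x hx, hC a (left_mem_Icc.2 hab)]

/-- The Leibniz rule for a continuous bilinear map and two primitives of integrable functions. -/
theorem bilinear [CompleteSpace E] [CompleteSpace F] [CompleteSpace G] (hab : a ≤ b)
    (L : E →L[ℝ] F →L[ℝ] G) {u g : ℝ → E} {v h : ℝ → F}
    (hu : IsPrimitiveOn a b u g) (hv : IsPrimitiveOn a b v h) :
    IsPrimitiveOn a b (fun x => L (u x) (v x)) (fun x => L (g x) (v x) + L (u x) (h x)) := by
  have ha : a ∈ Icc a b := left_mem_Icc.2 hab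
  obtain ⟨Cu, hCu⟩ := isCompact_Icc.exists_bound_of_continuousOn (hu.continuousOn hab)
  obtain ⟨Cv, hCv⟩ := isCompact_Icc.exists_bound_of_continuousOn (hv.continuousOn hab)
  have hCu0 : 0 ≤ Cu := (norm_nonneg _).trans (hCu a ha)
  have hCv0 : 0 ≤ Cv := (norm_nonneg _).trans (hCv a ha)
  have hint : IntervalIntegrable (fun x => L (g x) (v x) + L (u x) (h x)) volume a b := by
    rw [intervalIntegrable_iff_integrableOn_Icc_of_le hab]
    have hg := (intervalIntegrable_iff_integrableOn_Icc_of_le hab).1 hu.1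
    have hh := (intervalIntegrable_iff_integrableOn_Icc_of_le hab).1 hv.1
    have hum := (hu.continuousOn hab).aestronglyMeasurable (μ := volume) measurableSet_Icc
    have hvm := (hv.continuousOn hab).aestronglyMeasurable (μ := volume) measurableSet_Icc
    refine Integrable.add ?_ ?_
    · refine Integrable.mono' (hg.norm.const_mul (‖L‖ * Cv))
        (L.aestronglyMeasurable_comp₂ hg.aestronglyMeasurable hvm) ?_
      filter_upwards [ae_restrict_mem measurableSet_Icc] with x hx
      calc ‖L (g x) (v x)‖ ≤ ‖L‖ * ‖g x‖ * ‖v x‖ := L.le_opNorm₂ _ _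
        _ ≤ ‖L‖ * ‖g x‖ * Cv := by gcongr; exact hCv x hx
        _ = ‖L‖ * Cv * ‖g x‖ := by ring
    · refine Integrable.mono' (hh.norm.const_mul (‖L‖ * Cu))
        (L.aestronglyMeasurable_comp₂ hum hh.aestronglyMeasurable) ?_
      filter_upwards [ae_restrict_mem measurableSet_Icc] with x hx
      calc ‖L (u x) (h x)‖ ≤ ‖L‖ * ‖u x‖ * ‖h x‖ := L.le_opNorm₂ _ _
        _ ≤ ‖L‖ * Cu * ‖h x‖ := by gcongr; exact hCu x hx
  refine ⟨hint, ?_⟩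
  set k : ℝ → G := fun x => L (g x) (v x) + L (u x) (h x) with hk
  let N : ℝ → ℝ := fun t => ‖L‖ * Cv * ‖g t‖ + ‖L‖ * Cu * ‖h t‖ + ‖k t‖
  -- The factors are written as integrals rather than as `u` and `v`, since those are controlled
  -- only on `[a, b]` while a derivative at an end-point involves both sides.
  let f : ℝ → G := fun x => L (u a + ∫ t in a..x, g t) (v a + ∫ t in a..x, h t) - ∫ t in a..x, k t
  have hN : IntervalIntegrable N volume a b :=
    ((hu.1.norm.const_mul _).add (hv.1.norm.const_mul _)).add hint.norm
  have hfeq : ∀ x ∈ Icc a b, f x = L (u x) (v x) - ∫ t in a..x, k t := fun x hx => by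
    simp only [f]
    rw [← hu.2 x hx, ← hv.2 x hx]
  have hconst : ∀ x ∈ Icc a b, f x = f a := by
    refine eq_of_ae_hasDerivAt_zero hab hN ?_ ?_
    · intro x hx y hy hxy
      have hgi := IntervalIntegrable.of_mem_Icc hu.1 hx hy
      have hhi := IntervalIntegrable.of_mem_Icc hv.1 hx hy
      have hki := IntervalIntegrable.of_mem_Icc hint hx hy
      rw [hfeq x hx, hfeq y hy]
      have e : L (u y) (v y) - (∫ t in a..y, k t) - (L (u x) (v x) - ∫ t in a..x, k t) =
          L (u y - u x) (v y) + L (u x) (v y - v x) - ((∫ t in a..y, k t) - ∫ t in a..x, k t) := by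
        simp only [map_sub, sub_apply]
        abel
      rw [e, intervalIntegral.integral_interval_sub_left (IntervalIntegrable.of_mem_Icc hint ha hy)
        (IntervalIntegrable.of_mem_Icc hint ha hx), hu.sub_eq hx hy, hv.sub_eq hx hy,
        intervalIntegral.integral_add ((hgi.norm.const_mul _).add (hhi.norm.const_mul _)) hki.norm,
        intervalIntegral.integral_add (hgi.norm.const_mul _) (hhi.norm.const_mul _),
        intervalIntegral.integral_const_mul, intervalIntegral.integral_const_mul]
      refine (norm_sub_le _ _).trans (add_le_add ((norm_add_le _ _).trans (add_le_add ?_ ?_))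
        (intervalIntegral.norm_integral_le_integral_norm hxy))
      · calc _ ≤ ‖L‖ * ‖∫ t in x..y, g t‖ * ‖v y‖ := L.le_opNorm₂ _ _
          _ ≤ ‖L‖ * (∫ t in x..y, ‖g t‖) * Cv := by
            gcongr
            · exact mul_nonneg L.opNorm_nonneg
                (intervalIntegral.integral_nonneg hxy fun _ _ => norm_nonneg _)
            · exact intervalIntegral.norm_integral_le_integral_norm hxy
            · exact hCv y hy
          _ = _ := by ring
      · calc _ ≤ ‖L‖ * ‖u x‖ * ‖∫ t in x..y, h t‖ := L.le_opNorm₂ _ _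
          _ ≤ ‖L‖ * Cu * ∫ t in x..y, ‖h t‖ := by
            gcongr
            · exact hCu x hx
            · exact intervalIntegral.norm_integral_le_integral_norm hxy
    · filter_upwards [hu.1.ae_hasDerivAt_integral, hv.1.ae_hasDerivAt_integral,
        hint.ae_hasDerivAt_integral] with x hgx hhx hkx hx
      have h1 := (hgx hx a left_mem_uIcc).const_add (u a)
      have h2 := (hhx hx a left_mem_uIcc).const_add (v a)
      have h3 := hkx hx a left_mem_uIcc
      have h4 := (L.hasFDerivAt_of_bilinear h1.hasFDerivAt h2.hasFDerivAt).hasDerivAt.sub h3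
      rw [uIcc_of_le hab] at hx
      convert! h4 using 1
      simp [hk, hu.2 x hx, hv.2 x hx, add_comm]
  intro x hx
  have h1 := hconst x hx
  rw [hfeq x hx, hfeq a ha, intervalIntegral.integral_same, sub_zero, sub_eq_iff_eq_add] at h1
  exact h1

end IsPrimitiveOn

/-! ### Step functions on a subdivision -/

section StepFunction

variable {𝔸 : Type*} {m : ℕ}

/-- The step function with the value `B s` on the `s`-th interval of the subdivision `t`. -/
def stepFun [AddCommMonoid 𝔸] (t : Fin (m + 1) → ℝ) (B : Fin m → 𝔸) (x : ℝ) : 𝔸 :=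
  ∑ s : Fin m, (Ioc (t s.castSucc) (t s.succ)).indicator (fun _ => B s) x

theorem stepFun_apply [AddCommMonoid 𝔸] {t : Fin (m + 1) → ℝ} (ht : StrictMono t) (B : Fin m → 𝔸)
    {s : Fin m} {x : ℝ} (hx : x ∈ Ioc (t s.castSucc) (t s.succ)) : stepFun t B x = B s := by
  rw [stepFun, Finset.sum_eq_single s, indicator_of_mem hx]
  · intro r _ hrs
    refine indicator_of_notMem (fun hr => ?_) _
    rcases lt_or_gt_of_ne hrs with h | h
    · have : t r.succ ≤ t s.castSucc := ht.monotone (Fin.succ_le_castSucc_iff.2 h)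
      linarith [hx.1, hr.2]
    · have : t s.succ ≤ t r.castSucc := ht.monotone (Fin.succ_le_castSucc_iff.2 h)
      linarith [hx.2, hr.1]
  · simp

theorem exists_mem_Ioc_of_mem_Ioc {t : Fin (m + 1) → ℝ} {x : ℝ}
    (hx : x ∈ Ioc (t 0) (t (Fin.last m))) : ∃ s : Fin m, x ∈ Ioc (t s.castSucc) (t s.succ) := by
  by_contra! h
  have key : ∀ i : Fin (m + 1), t i < x := by
    intro i
    induction i using Fin.induction with
    | zero => exact hx.1
    | succ i ih =>
      by_contra! hle
      exact h i ⟨ih, hle⟩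
  exact (key _).not_ge hx.2

theorem stronglyMeasurable_stepFun [NormedAddCommGroup 𝔸] (t : Fin (m + 1) → ℝ) (B : Fin m → 𝔸) :
    StronglyMeasurable (stepFun t B) := by
  unfold stepFun
  exact Finset.stronglyMeasurable_fun_sum _ fun s _ =>
    stronglyMeasurable_const.indicator measurableSet_Ioc

theorem norm_stepFun_le [NormedAddCommGroup 𝔸] (t : Fin (m + 1) → ℝ) (B : Fin m → 𝔸) (x : ℝ) :
    ‖stepFun t B x‖ ≤ ∑ s, ‖B s‖ :=
  (norm_sum_le _ _).trans (Finset.sum_le_sum fun _ _ => norm_indicator_le_norm_self _ _)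

theorem intervalIntegrable_stepFun [NormedAddCommGroup 𝔸] (t : Fin (m + 1) → ℝ) (B : Fin m → 𝔸)
    (a b : ℝ) : IntervalIntegrable (stepFun t B) volume a b :=
  (intervalIntegrable_const (c := ∑ s, ‖B s‖)).mono_fun
    (stronglyMeasurable_stepFun t B).aestronglyMeasurable
    (Filter.Eventually.of_forall fun x => (norm_stepFun_le t B x).trans (le_abs_self _))

end StepFunction

/-! ### Propagator of a system with piecewise constant coefficients -/

section Propagator

variable {𝔸 : Type*} [NormedRing 𝔸] [NormedAlgebra ℝ 𝔸] {m : ℕ}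

/-- The fundamental solution of `U' = B U` with `U = 1` to the left of the subdivision `t`, where
`B` is the step function with the value `B s` on the `s`-th interval of `t` and zero elsewhere. -/
def propagator (t : Fin (m + 1) → ℝ) (B : Fin m → 𝔸) (x : ℝ) : 𝔸 :=
  (List.ofFn fun s : Fin m =>
    NormedSpace.exp ((max (min x (t s.succ)) (t s.castSucc) - t s.castSucc) • B s)).reverse.prod

theorem propagator_succ (t : Fin (m + 2) → ℝ) (B : Fin (m + 1) → 𝔸) (x : ℝ) :
    propagator t B x =
      NormedSpace.exp ((max (min x (t (Fin.last m).succ)) (t (Fin.last m).castSucc)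
        - t (Fin.last m).castSucc) • B (Fin.last m)) *
      propagator (fun i : Fin (m + 1) => t i.castSucc) (fun s => B s.castSucc) x := by
  simp only [propagator, List.ofFn_succ', List.concat_eq_append, List.reverse_append,
    List.reverse_singleton, List.singleton_append, List.prod_cons, Fin.succ_castSucc]

theorem propagator_left {t : Fin (m + 1) → ℝ} (ht : StrictMono t) (B : Fin m → 𝔸) :
    propagator t B (t 0) = 1 := by
  refine List.prod_eq_one fun y hy => ?_
  rw [List.mem_reverse, List.mem_ofFn] at hy
  obtain ⟨s, rfl⟩ := hy
  have h1 : t 0 ≤ t s.castSucc := ht.monotone (Fin.zero_le _)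
  rw [max_eq_right ((min_le_left _ _).trans h1), sub_self, zero_smul, NormedSpace.exp_zero]

theorem propagator_right {t : Fin (m + 1) → ℝ} (ht : StrictMono t) (B : Fin m → 𝔸) :
    propagator t B (t (Fin.last m)) = (List.ofFn fun s : Fin m =>
      NormedSpace.exp ((t s.succ - t s.castSucc) • B s)).reverse.prod := by
  unfold propagator
  congr 3
  funext s
  have h1 : t s.succ ≤ t (Fin.last m) := ht.monotone (Fin.le_last _)
  have h2 : t s.castSucc ≤ t s.succ := ht.monotone (Fin.castSucc_lt_succ).le
  rw [min_eq_right h1, max_eq_left h2]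

variable [CompleteSpace 𝔸]

theorem continuous_propagator (t : Fin (m + 1) → ℝ) (B : Fin m → 𝔸) :
    Continuous (propagator t B) := by
  let _ : NormedAlgebra ℚ 𝔸 := NormedAlgebra.restrictScalars ℚ ℝ 𝔸
  induction m with
  | zero => exact (continuous_const (y := (1 : 𝔸))).congr fun x => by simp [propagator]
  | succ m ih =>
    simp_rw [funext (propagator_succ t B)]
    exact (NormedSpace.exp_continuous.comp (by fun_prop)).mul (ih _ _)

theorem isUnit_propagator (t : Fin (m + 1) → ℝ) (B : Fin m → 𝔸) (x : ℝ) :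
    IsUnit (propagator t B x) := by
  let _ : NormedAlgebra ℚ 𝔸 := NormedAlgebra.restrictScalars ℚ ℝ 𝔸
  induction m with
  | zero => simp [propagator]
  | succ m ih =>
    rw [propagator_succ]
    exact (NormedSpace.isUnit_exp _).mul (ih _ _)

/-- Induction that peels off the last interval `(p, q]`. Left of `p` the last factor is `1`; between
`p` and `q` it alone varies, as an exponential; right of `q` it is frozen and the step function
vanishes. -/
theorem hasDerivAt_propagator {t : Fin (m + 1) → ℝ} (ht : StrictMono t) (B : Fin m → 𝔸) {x : ℝ}
    (hx : x ∉ range t) : HasDerivAt (propagator t B) (stepFun t B x * propagator t B x) x := by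
  induction m with
  | zero =>
    have h1 : propagator t B = fun _ => 1 := by funext y; simp [propagator]
    have h2 : stepFun t B x = 0 := by simp [stepFun]
    rw [h2, zero_mul, h1]
    exact hasDerivAt_const _ _
  | succ m ih =>
    set p := t (Fin.last m).castSucc with hp
    set q := t (Fin.last m).succ with hq
    have hpq : p < q := ht Fin.castSucc_lt_succ
    have hxp : x ≠ p := fun h => hx ⟨_, h.symm⟩
    have hxq : x ≠ q := fun h => hx ⟨_, h.symm⟩
    set t' : Fin (m + 1) → ℝ := fun i => t i.castSucc
    set B' : Fin m → 𝔸 := fun s => B s.castSucc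
    have ht' : StrictMono t' := ht.comp (Fin.strictMono_castSucc)
    have hd := ih ht' B' (fun ⟨i, hi⟩ => hx ⟨i.castSucc, hi⟩)
    have hstep : stepFun t B x =
        stepFun t' B' x + (Ioc p q).indicator (fun _ => B (Fin.last m)) x := by
      rw [stepFun, Fin.sum_univ_castSucc]
      rfl
    have hzero : p < x → stepFun t' B' x = 0 := fun h =>
      Finset.sum_eq_zero fun s _ => indicator_of_notMem (fun hs => by
        have : t' s.succ ≤ p := ht.monotone (Fin.castSucc_le_castSucc_iff.2 (Fin.le_last _))
        linarith [hs.2]) _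
    have hU : ∀ y, propagator t B y =
        NormedSpace.exp ((max (min y q) p - p) • B (Fin.last m)) * propagator t' B' y :=
      propagator_succ t B
    rcases lt_or_gt_of_ne hxp with h | h
    · have hev : propagator t B =ᶠ[nhds x] propagator t' B' := by
        filter_upwards [Iio_mem_nhds h] with y hy
        rw [hU, max_eq_right ((min_le_left _ _).trans (le_of_lt hy)), sub_self, zero_smul,
          NormedSpace.exp_zero, one_mul]
      rw [hev.eq_of_nhds, hstep, indicator_of_notMem (fun h' => h'.1.not_gt h), add_zero]
      exact hd.congr_of_eventuallyEq hev
    · rw [hzero h, zero_mul] at hd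
      rw [hstep, hzero h, zero_add]
      rcases lt_or_gt_of_ne hxq with h' | h'
      · have hev : propagator t B =ᶠ[nhds x] fun y =>
            NormedSpace.exp ((y - p) • B (Fin.last m)) * propagator t' B' y := by
          filter_upwards [Ioo_mem_nhds h h'] with y hy
          rw [hU, min_eq_left hy.2.le, max_eq_left hy.1.le]
        rw [hev.eq_of_nhds, indicator_of_mem (show x ∈ Ioc p q from ⟨h, h'.le⟩)]
        refine HasDerivAt.congr_of_eventuallyEq ?_ hev
        have h1 : HasDerivAt (fun y => NormedSpace.exp ((y - p) • B (Fin.last m)))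
            (B (Fin.last m) * NormedSpace.exp ((x - p) • B (Fin.last m))) x :=
          (hasDerivAt_exp_smul_const' (B (Fin.last m)) (x - p)).comp_sub_const x p
        simpa [mul_assoc] using h1.fun_mul hd
      · have hev : propagator t B =ᶠ[nhds x] fun y =>
            NormedSpace.exp ((q - p) • B (Fin.last m)) * propagator t' B' y := by
          filter_upwards [Ioi_mem_nhds h'] with y hy
          rw [hU, min_eq_right (le_of_lt hy), max_eq_left hpq.le]
        rw [indicator_of_notMem (fun h'' => h''.2.not_gt h'), zero_mul]
        refine HasDerivAt.congr_of_eventuallyEq ?_ hev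
        simpa using hd.const_mul (NormedSpace.exp ((q - p) • B (Fin.last m)))

theorem IsPrimitiveOn.of_hasDerivAt_off_finite {E : Type*} [NormedAddCommGroup E] [NormedSpace ℝ E]
    [CompleteSpace E] {a b : ℝ} {f g : ℝ → E} {s : Set ℝ} (hs : s.Finite) (hf : Continuous f)
    (hfg : ∀ x ∉ s, HasDerivAt f (g x) x) (hg : IntervalIntegrable g volume a b) :
    IsPrimitiveOn a b f g := by
  refine ⟨hg, fun x hx => ?_⟩
  rw [integral_eq_of_hasDerivAt_off_countable_of_le f g hx.1 hs.countable hf.continuousOn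
    (fun y hy => hfg y hy.2)
    (IntervalIntegrable.of_mem_Icc hg (left_mem_Icc.2 (hx.1.trans hx.2)) hx)]
  abel

theorem isPrimitiveOn_propagator {t : Fin (m + 1) → ℝ} (ht : StrictMono t) (B : Fin m → 𝔸)
    (a b : ℝ) :
    IsPrimitiveOn a b (propagator t B) (fun x => stepFun t B x * propagator t B x) :=
  .of_hasDerivAt_off_finite (finite_range t) (continuous_propagator t B)
    (fun _ hx => hasDerivAt_propagator ht B hx)
    ((intervalIntegrable_stepFun t B a b).mul_continuousOn (continuous_propagator t B).continuousOn)

/-- With `U' = B U`, the derivative `-U⁻¹ U' U⁻¹` of the inverse collapses to `-U⁻¹ B`. -/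
theorem isPrimitiveOn_inverse_propagator {t : Fin (m + 1) → ℝ} (ht : StrictMono t)
    (B : Fin m → 𝔸) (a b : ℝ) :
    IsPrimitiveOn a b (fun x => Ring.inverse (propagator t B x))
      (fun x => -(Ring.inverse (propagator t B x) * stepFun t B x)) := by
  have hc : Continuous fun x => Ring.inverse (propagator t B x) := by
    rw [continuous_iff_continuousAt]
    intro x
    obtain ⟨v, hv⟩ := isUnit_propagator t B x
    exact ContinuousAt.comp (hv ▸ NormedRing.inverse_continuousAt v)
      (continuous_propagator t B).continuousAt
  refine .of_hasDerivAt_off_finite (finite_range t) hc (fun x hx => ?_)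
    (((intervalIntegrable_stepFun t B a b).continuousOn_mul hc.continuousOn).neg)
  obtain ⟨v, hv⟩ := isUnit_propagator t B x
  have h1 := hasFDerivAt_ringInverse (𝕜 := ℝ) v
  rw [hv] at h1
  have h2 := h1.comp_hasDerivAt x (hasDerivAt_propagator ht B hx)
  convert! h2 using 1
  rw [← hv]
  simp [mul_assoc]

end Propagator

/-! ### Variation of constants -/

theorem IsPrimitiveOn.congr {E : Type*} [NormedAddCommGroup E] [NormedSpace ℝ E] {a b : ℝ}
    {u g g' : ℝ → E} (h : IsPrimitiveOn a b u g) (hgg' : ∀ x, g x = g' x) :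
    IsPrimitiveOn a b u g' := funext hgg' ▸ h

section VariationOfConstants

variable {E : Type*} [NormedAddCommGroup E] [NormedSpace ℂ E] [CompleteSpace E] {m : ℕ}

theorem IsPrimitiveOn.clm_apply {a b : ℝ} (hab : a ≤ b) {Φ φ : ℝ → E →L[ℂ] E} {u g : ℝ → E}
    (hΦ : IsPrimitiveOn a b Φ φ) (hu : IsPrimitiveOn a b u g) :
    IsPrimitiveOn a b (fun x => Φ x (u x)) (fun x => φ x (u x) + Φ x (g x)) :=
  IsPrimitiveOn.bilinear hab
    ((ContinuousLinearMap.id ℂ (E →L[ℂ] E)).bilinearRestrictScalars ℝ) hΦ hu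

variable {t : Fin (m + 1) → ℝ}

/-- The inhomogeneity of a linear system, pulled back by the propagator and integrated. -/
def pullbackIntegral (t : Fin (m + 1) → ℝ) (B : Fin m → E →L[ℂ] E) (k : ℝ → E) (x : ℝ) : E :=
  ∫ s in t 0..x, Ring.inverse (propagator t B s) (k s)

theorem intervalIntegrable_pullback (ht : StrictMono t) (B : Fin m → E →L[ℂ] E) {k : ℝ → E}
    (hk : IntervalIntegrable k volume (t 0) (t (Fin.last m))) :
    IntervalIntegrable (fun s => Ring.inverse (propagator t B s) (k s)) volume
      (t 0) (t (Fin.last m)) := by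
  have hab : t 0 ≤ t (Fin.last m) := ht.monotone (Fin.zero_le _)
  have hc := (isPrimitiveOn_inverse_propagator ht B (t 0) (t (Fin.last m))).continuousOn hab
  obtain ⟨C, hC⟩ := isCompact_Icc.exists_bound_of_continuousOn hc
  rw [intervalIntegrable_iff_integrableOn_Icc_of_le hab] at hk ⊢
  refine Integrable.mono' (hk.norm.const_mul C)
    ((ContinuousLinearMap.id ℂ (E →L[ℂ] E)).aestronglyMeasurable_comp₂
      (hc.aestronglyMeasurable measurableSet_Icc) hk.aestronglyMeasurable) ?_
  filter_upwards [ae_restrict_mem measurableSet_Icc] with x hx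
  exact ContinuousLinearMap.le_of_opNorm_le _ (hC x hx) _

/-- Variation of constants: the formula solves the inhomogeneous system. -/
theorem isPrimitiveOn_propagator_apply (ht : StrictMono t) (B : Fin m → E →L[ℂ] E) {k : ℝ → E}
    (hk : IntervalIntegrable k volume (t 0) (t (Fin.last m))) (c : E) :
    IsPrimitiveOn (t 0) (t (Fin.last m))
      (fun x => propagator t B x (c + pullbackIntegral t B k x))
      (fun x => stepFun t B x (propagator t B x (c + pullbackIntegral t B k x)) + k x) := by
  have hab : t 0 ≤ t (Fin.last m) := ht.monotone (Fin.zero_le _)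
  have hw : IsPrimitiveOn (t 0) (t (Fin.last m)) (fun x => c + pullbackIntegral t B k x)
      (fun s => Ring.inverse (propagator t B s) (k s)) :=
    ⟨intervalIntegrable_pullback ht B hk, fun x _ => by simp [pullbackIntegral]⟩
  refine (IsPrimitiveOn.clm_apply hab (isPrimitiveOn_propagator ht B _ _) hw).congr fun x => ?_
  rw [← mul_apply_eq_comp (propagator t B x),
    Ring.mul_inverse_cancel _ (isUnit_propagator t B x)]
  rfl

/-- Variation of constants: every solution of the inhomogeneous system is given by the formula. -/
theorem eq_propagator_apply (ht : StrictMono t) (B : Fin m → E →L[ℂ] E) {k u : ℝ → E}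
    (hu : IsPrimitiveOn (t 0) (t (Fin.last m)) u (fun x => stepFun t B x (u x) + k x))
    {x : ℝ} (hx : x ∈ Icc (t 0) (t (Fin.last m))) :
    u x = propagator t B x (u (t 0) + pullbackIntegral t B k x) := by
  have hab : t 0 ≤ t (Fin.last m) := ht.monotone (Fin.zero_le _)
  -- In the derivative of `U⁻¹ u` the terms `∓U⁻¹ B u` cancel and only `U⁻¹ k` remains.
  have h := (IsPrimitiveOn.clm_apply hab (isPrimitiveOn_inverse_propagator ht B _ _) hu).congr
    (g' := fun s => Ring.inverse (propagator t B s) (k s)) fun x => by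
      simp
  have h1 := h.2 x hx
  simp only [propagator_left ht, Ring.inverse_one, one_apply_eq_self] at h1
  rw [pullbackIntegral, ← h1, ← mul_apply_eq_comp,
    Ring.mul_inverse_cancel _ (isUnit_propagator t B x), one_apply_eq_self]

end VariationOfConstants

/-! ### Square-integrable functions on an interval -/

theorem MeasureTheory.MemLp.stepFun_apply {n m : ℕ} {μ : Measure ℝ} {p : ENNReal}
    {f : ℝ → EuclideanSpace ℂ (Fin n)} (hf : MemLp f p μ) (t : Fin (m + 1) → ℝ)
    (B : Fin m → EuclideanSpace ℂ (Fin n) →L[ℂ] EuclideanSpace ℂ (Fin n)) :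
    MemLp (fun x => stepFun t B x (f x)) p μ :=
  hf.of_le_mul ((ContinuousLinearMap.id ℂ _).aestronglyMeasurable_comp₂
    (stronglyMeasurable_stepFun t B).aestronglyMeasurable hf.aestronglyMeasurable)
    (Filter.Eventually.of_forall fun x =>
      ContinuousLinearMap.le_of_opNorm_le _ (norm_stepFun_le t B x) _)

namespace L2Interval

variable {n : ℕ} {a b : ℝ}

/-- The `L¹` norm on a bounded interval is controlled by the `L²` norm. -/
theorem exists_integral_norm_le (n : ℕ) {a b : ℝ} (hab : a ≤ b) :
    ∃ C : ℝ, 0 ≤ C ∧ ∀ h : L2Interval n a b, ∫ x in a..b, ‖h x‖ ≤ C * ‖h‖ := by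
  set μ := volume.restrict (Ioo a b)
  refine ⟨(μ univ ^ (1 / (1 : ENNReal).toReal - 1 / (2 : ENNReal).toReal)).toReal,
    ENNReal.toReal_nonneg, fun h => ?_⟩
  have h1 : MemLp h 1 μ := (Lp.memLp h).mono_exponent (by norm_num)
  rw [intervalIntegral.integral_of_le hab, integral_Ioc_eq_integral_Ioo,
    integral_norm_eq_lintegral_enorm h1.aestronglyMeasurable, ← eLpNorm_one_eq_lintegral_enorm,
    Lp.norm_def, mul_comm, ← ENNReal.toReal_mul]
  refine ENNReal.toReal_mono (ENNReal.mul_ne_top (Lp.eLpNorm_ne_top h) ?_)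
    (eLpNorm_le_eLpNorm_mul_rpow_measure_univ (by norm_num) h1.aestronglyMeasurable)
  refine ENNReal.rpow_ne_top_of_nonneg (by norm_num) (measure_ne_top _ _)

theorem ae_mem_Ioo : ∀ᵐ x ∂volume.restrict (Ioo a b), x ∈ Ioo a b :=
  ae_restrict_mem measurableSet_Ioo

theorem integral_congr {g g' : ℝ → EuclideanSpace ℂ (Fin n)}
    (h : ∀ᵐ x ∂volume.restrict (Ioo a b), g x = g' x) {x : ℝ} (hx : x ∈ Icc a b) :
    ∫ t in a..x, g t = ∫ t in a..x, g' t := by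
  apply intervalIntegral.integral_congr_ae_restrict
  rw [uIoc_of_le hx.1, ← restrict_Ioo_eq_restrict_Ioc]
  exact ae_restrict_of_ae_restrict_of_subset (Ioo_subset_Ioo_right hx.2) h

end L2Interval

theorem IsW12.isPrimitiveOn {n : ℕ} {a b : ℝ} (hab : a ≤ b) {u g' : ℝ → EuclideanSpace ℂ (Fin n)}
    {g : L2Interval n a b} (hu : IsW12 u g)
    (hg : ∀ᵐ x ∂volume.restrict (Ioo a b), g x = g' x) : IsPrimitiveOn a b u g' := by
  refine ⟨?_, fun x hx => by rw [hu x hx, L2Interval.integral_congr hg hx]⟩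
  have h := g.intervalIntegrable hab
  rw [intervalIntegrable_iff_integrableOn_Ioo_of_le hab] at h ⊢
  exact Integrable.congr h hg

/-! ### Resolvent, eigenfunctions and spectrum of the operator -/

namespace EllipticSystem

variable {n m : ℕ} (P : EllipticSystem n m) (z : ℂ)

/-- The inverse of the coefficient `A(x)`. -/
def invCoeff (x : ℝ) : EuclideanSpace ℂ (Fin n) →L[ℂ] EuclideanSpace ℂ (Fin n) :=
  stepFun P.node (fun s => Matrix.toEuclideanCLM (𝕜 := ℂ) (P.A s)⁻¹) x

/-- The coefficients of the system `u' = z A⁻¹ u`. -/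
def generator (s : Fin m) : EuclideanSpace ℂ (Fin n) →L[ℂ] EuclideanSpace ℂ (Fin n) :=
  z • Matrix.toEuclideanCLM (𝕜 := ℂ) (P.A s)⁻¹

/-- The fundamental solution of the system `u' = z A⁻¹ u`. -/
def flow (x : ℝ) : EuclideanSpace ℂ (Fin n) →L[ℂ] EuclideanSpace ℂ (Fin n) :=
  propagator P.node (P.generator z) x

/-- The general solution of `A u' - z u = h`, with initial value `c`. -/
def solution (h : ℝ → EuclideanSpace ℂ (Fin n)) (c : EuclideanSpace ℂ (Fin n)) (x : ℝ) :
    EuclideanSpace ℂ (Fin n) :=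
  P.flow z x (c + pullbackIntegral P.node (P.generator z) (fun s => P.invCoeff s (h s)) x)

theorem solution_left (h : ℝ → EuclideanSpace ℂ (Fin n)) (c : EuclideanSpace ℂ (Fin n)) :
    P.solution z h c P.left = c := by
  simp [solution, flow, left, propagator_left P.node_strictMono, pullbackIntegral]

theorem stepFun_generator (x : ℝ) : stepFun P.node (P.generator z) x = z • P.invCoeff x := by
  simp only [invCoeff, stepFun, Finset.smul_sum, generator]
  refine Finset.sum_congr rfl fun s _ => ?_
  rw [← indicator_const_smul_apply]

theorem toEuclideanLin_coeff_invCoeff {x : ℝ} (hx : x ∈ Ioo P.left P.right)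
    (v : EuclideanSpace ℂ (Fin n)) : (P.coeff x).toEuclideanLin (P.invCoeff x v) = v := by
  obtain ⟨s, hs⟩ := exists_mem_Ioc_of_mem_Ioc (t := P.node) ⟨hx.1, hx.2.le⟩
  have h1 : P.coeff x = P.A s := stepFun_apply P.node_strictMono P.A hs
  rw [h1, invCoeff, stepFun_apply P.node_strictMono _ hs,
    ← Matrix.coe_toEuclideanCLM_eq_toEuclideanLin, ContinuousLinearMap.coe_coe,
    ← mul_apply_eq_comp, ← map_mul,
    Matrix.mul_nonsing_inv _ ((Matrix.isUnit_iff_isUnit_det _).1 (P.A_invertible s)), map_one,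
    one_apply_eq_self]

theorem invCoeff_toEuclideanLin_coeff {x : ℝ} (hx : x ∈ Ioo P.left P.right)
    (v : EuclideanSpace ℂ (Fin n)) : P.invCoeff x ((P.coeff x).toEuclideanLin v) = v := by
  obtain ⟨s, hs⟩ := exists_mem_Ioc_of_mem_Ioc (t := P.node) ⟨hx.1, hx.2.le⟩
  have h1 : P.coeff x = P.A s := stepFun_apply P.node_strictMono P.A hs
  rw [h1, invCoeff, stepFun_apply P.node_strictMono _ hs,
    ← Matrix.coe_toEuclideanCLM_eq_toEuclideanLin, ContinuousLinearMap.coe_coe,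
    ← mul_apply_eq_comp, ← map_mul,
    Matrix.nonsing_inv_mul _ ((Matrix.isUnit_iff_isUnit_det _).1 (P.A_invertible s)), map_one,
    one_apply_eq_self]

-- An algebra homomorphism commutes with the exponential series once it is continuous, and linear
-- maps in finite dimension are.
open scoped Matrix.Norms.L2Operator in
theorem _root_.Matrix.toEuclideanCLM_exp (M : Matrix (Fin n) (Fin n) ℂ) :
    Matrix.toEuclideanCLM (𝕜 := ℂ) (NormedSpace.exp M) =
      NormedSpace.exp (Matrix.toEuclideanCLM (𝕜 := ℂ) M) := by
  let _ : NormedAlgebra ℚ (Matrix (Fin n) (Fin n) ℂ) := NormedAlgebra.restrictScalars ℚ ℂ _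
  refine NormedSpace.map_exp (Matrix.toEuclideanCLM (n := Fin n) (𝕜 := ℂ)) ?_ M
  exact LinearMap.continuous_of_finiteDimensional
    { toFun := Matrix.toEuclideanCLM (n := Fin n) (𝕜 := ℂ)
      map_add' := map_add _
      map_smul' := map_smul _ }

theorem flow_right : P.flow z P.right = Matrix.toEuclideanCLM (𝕜 := ℂ) (P.transfer z) := by
  rw [flow, right, propagator_right P.node_strictMono, transfer, map_list_prod, List.map_reverse,
    List.map_ofFn]
  congr 3
  funext s
  rw [Function.comp_apply, Matrix.toEuclideanCLM_exp, map_smul, generator, mul_comm, mul_smul]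
  rfl

/-- The boundary condition for solutions of the homogeneous equation. -/
theorem boundary_eq (c w : EuclideanSpace ℂ (Fin n)) :
    P.S.toEuclideanLin c + P.T.toEuclideanLin (P.flow z P.right (c + w)) =
      Matrix.toEuclideanCLM (𝕜 := ℂ) (P.S + P.T * P.transfer z) c +
        Matrix.toEuclideanCLM (𝕜 := ℂ) (P.T * P.transfer z) w := by
  rw [← Matrix.coe_toEuclideanCLM_eq_toEuclideanLin, ← Matrix.coe_toEuclideanCLM_eq_toEuclideanLin,
    flow_right, map_add, map_mul]
  simp [add_assoc]

theorem intervalIntegrable_invCoeff (h : L2Interval n P.left P.right) :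
    IntervalIntegrable (fun x => P.invCoeff x (h x)) volume P.left P.right := by
  rw [intervalIntegrable_iff_integrableOn_Ioo_of_le P.left_lt_right.le]
  exact ((Lp.memLp h).stepFun_apply P.node _).integrable (by norm_num)

theorem isPrimitiveOn_solution (h : L2Interval n P.left P.right) (c : EuclideanSpace ℂ (Fin n)) :
    IsPrimitiveOn P.left P.right (P.solution z h c)
      (fun x => P.invCoeff x (z • P.solution z h c x + h x)) :=
  (isPrimitiveOn_propagator_apply P.node_strictMono (P.generator z)
    (P.intervalIntegrable_invCoeff h) c).congr fun x => by
      rw [stepFun_generator, smul_apply, map_add (P.invCoeff x), map_smul (P.invCoeff x)]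
      rfl

/-- Solutions of `A u' - z u = h` that satisfy the boundary condition lie in the domain. -/
theorem exists_mem_graph (h : L2Interval n P.left P.right) (c : EuclideanSpace ℂ (Fin n))
    (hc : P.S.toEuclideanLin c + P.T.toEuclideanLin (P.solution z h c P.right) = 0) :
    ∃ f : L2Interval n P.left P.right,
      (∀ᵐ x ∂volume.restrict (Ioo P.left P.right), f x = P.solution z h c x) ∧
      (f, z • f + h) ∈ P.graph := by
  have hprim := P.isPrimitiveOn_solution z h c
  have hcont := hprim.continuousOn P.left_lt_right.le
  have hu : MemLp (P.solution z h c) 2 (volume.restrict (Ioo P.left P.right)) := by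
    obtain ⟨C, hC⟩ := isCompact_Icc.exists_bound_of_continuousOn hcont
    refine MemLp.of_bound
      ((hcont.mono Ioo_subset_Icc_self).aestronglyMeasurable measurableSet_Ioo) C ?_
    filter_upwards [L2Interval.ae_mem_Ioo] with x hx using hC x (Ioo_subset_Icc_self hx)
  have hg : MemLp (fun x => P.invCoeff x (z • P.solution z h c x + h x)) 2
      (volume.restrict (Ioo P.left P.right)) :=
    ((hu.const_smul z).add (Lp.memLp h)).stepFun_apply P.node _
  refine ⟨hu.toLp, hu.coeFn_toLp, P.solution z h c, hg.toLp, ?_, hu.coeFn_toLp, ?_, ?_⟩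
  · intro x hx
    rw [L2Interval.integral_congr hg.coeFn_toLp hx]
    exact hprim.2 x hx
  · filter_upwards [hg.coeFn_toLp, hu.coeFn_toLp, L2Interval.ae_mem_Ioo,
      Lp.coeFn_add (z • hu.toLp) h, Lp.coeFn_smul z hu.toLp] with x h1 h2 hx h3 h4
    rw [h3, Pi.add_apply, h4, Pi.smul_apply, h1, h2, P.toEuclideanLin_coeff_invCoeff hx]
  · rwa [solution_left]

/-- Elements of the domain solve `A u' - z u = h`. -/
theorem exists_eq_solution {f k : L2Interval n P.left P.right} (hf : (f, k) ∈ P.graph) :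
    ∃ c : EuclideanSpace ℂ (Fin n),
      (∀ᵐ x ∂volume.restrict (Ioo P.left P.right),
        f x = P.solution z (k - z • f : L2Interval n P.left P.right) c x) ∧
      P.S.toEuclideanLin c + P.T.toEuclideanLin
        (P.solution z (k - z • f : L2Interval n P.left P.right) c P.right) = 0 := by
  obtain ⟨u, g, hw, hfu, hk, hb⟩ := hf
  set h : L2Interval n P.left P.right := k - z • f with hh
  have hg : ∀ᵐ x ∂volume.restrict (Ioo P.left P.right),
      g x = stepFun P.node (P.generator z) x (u x) + P.invCoeff x (h x) := by
    filter_upwards [hfu, hk, L2Interval.ae_mem_Ioo, Lp.coeFn_sub k (z • f), Lp.coeFn_smul z f]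
      with x h1 h2 hx h3 h4
    rw [stepFun_generator, smul_apply, ← map_smul, ← map_add, hh, h3, Pi.sub_apply, h4,
      Pi.smul_apply, ← h1, h2, add_sub_cancel, P.invCoeff_toEuclideanLin_coeff hx]
  have hsol : ∀ x ∈ Icc P.left P.right, u x = P.solution z h (u P.left) x := fun x hx =>
    eq_propagator_apply P.node_strictMono (P.generator z)
      (hw.isPrimitiveOn P.left_lt_right.le hg) hx
  refine ⟨u P.left, ?_, ?_⟩
  · filter_upwards [hfu, L2Interval.ae_mem_Ioo] with x h1 hx
    rw [h1, hsol x (Ioo_subset_Icc_self hx)]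
  · rwa [← hsol _ (right_mem_Icc.2 P.left_lt_right.le)]

theorem exists_norm_pullbackIntegral_le : ∃ K : ℝ, 0 ≤ K ∧
    ∀ h : L2Interval n P.left P.right, ∀ x ∈ Icc P.left P.right,
      ‖pullbackIntegral P.node (P.generator z) (fun s => P.invCoeff s (h s)) x‖ ≤ K * ‖h‖ := by
  have hab := P.left_lt_right.le
  obtain ⟨C, hC0, hC⟩ := L2Interval.exists_integral_norm_le n hab
  obtain ⟨CY, hCY⟩ := isCompact_Icc.exists_bound_of_continuousOn
    ((isPrimitiveOn_inverse_propagator P.node_strictMono (P.generator z)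
      P.left P.right).continuousOn hab)
  have hCY0 : 0 ≤ CY := (norm_nonneg _).trans (hCY _ (left_mem_Icc.2 hab))
  set CJ := ∑ s, ‖Matrix.toEuclideanCLM (𝕜 := ℂ) (P.A s)⁻¹‖
  have hCJ0 : 0 ≤ CJ := Finset.sum_nonneg fun _ _ => norm_nonneg _
  refine ⟨CY * CJ * C, by positivity, fun h x hx => ?_⟩
  have hint : IntervalIntegrable (fun s => CY * CJ * ‖h s‖) volume P.left P.right :=
    (h.intervalIntegrable hab).norm.const_mul _
  calc _ ≤ ∫ s in P.left..x, CY * CJ * ‖h s‖ := by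
        refine intervalIntegral.norm_integral_le_of_norm_le hx.1 ?_
          (hint.of_mem_Icc (left_mem_Icc.2 hab) hx)
        refine Filter.Eventually.of_forall fun s hs => ?_
        rw [mul_assoc]
        exact ContinuousLinearMap.le_of_opNorm_le_of_le _ (hCY s ⟨hs.1.le, hs.2.trans hx.2⟩)
          (ContinuousLinearMap.le_of_opNorm_le _ (norm_stepFun_le _ _ _) _)
    _ ≤ ∫ s in P.left..P.right, CY * CJ * ‖h s‖ :=
        intervalIntegral.integral_mono_interval le_rfl hx.1 hx.2
          (Filter.Eventually.of_forall fun s => by positivity) hint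
    _ = CY * CJ * ∫ s in P.left..P.right, ‖h s‖ := intervalIntegral.integral_const_mul _ _
    _ ≤ CY * CJ * (C * ‖h‖) := by gcongr; exact hC h
    _ = _ := by ring

/-- The solutions that satisfy the boundary conditions are controlled by the right-hand side. -/
theorem exists_norm_le (hz : P.F z ≠ 0) : ∃ C : ℝ, 0 ≤ C ∧
    ∀ f k : L2Interval n P.left P.right, (f, k) ∈ P.graph → ‖f‖ ≤ C * ‖k - z • f‖ := by
  have hab := P.left_lt_right.le
  obtain ⟨K, hK0, hK⟩ := P.exists_norm_pullbackIntegral_le z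
  obtain ⟨CU, hCU⟩ := isCompact_Icc.exists_bound_of_continuousOn
    (continuous_propagator P.node (P.generator z)).continuousOn (s := Icc P.left P.right)
  have hCU0 : 0 ≤ CU := (norm_nonneg _).trans (hCU _ (left_mem_Icc.2 hab))
  set M := P.S + P.T * P.transfer z
  set D := ‖Matrix.toEuclideanCLM (𝕜 := ℂ) (M⁻¹ * (P.T * P.transfer z))‖
  -- The square root of the interval length passes from a uniform bound to the `L²` norm. `D * K`
  -- bounds the initial value, `K` the integral term and `CU` the propagator.
  refine ⟨measureUnivNNReal (volume.restrict (Ioo P.left P.right)) ^ (ENNReal.toReal 2)⁻¹ *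
    (CU * (D * K + K)), by positivity, fun f k hf => ?_⟩
  obtain ⟨c, hfc, hb⟩ := P.exists_eq_solution z hf
  set h : L2Interval n P.left P.right := k - z • f
  set w := pullbackIntegral P.node (P.generator z) (fun s => P.invCoeff s (h s)) P.right
  -- The boundary condition reads `M c + T U w = 0`, and `M` is invertible because its determinant
  -- is `F z`.
  have hc : c = -(Matrix.toEuclideanCLM (𝕜 := ℂ) (M⁻¹ * (P.T * P.transfer z)) w) := by
    rw [solution, boundary_eq] at hb
    have h1 := congrArg (Matrix.toEuclideanCLM (𝕜 := ℂ) M⁻¹) hb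
    rw [map_add, ← mul_apply_eq_comp, ← mul_apply_eq_comp, ← map_mul, ← map_mul,
      Matrix.nonsing_inv_mul _ (isUnit_iff_ne_zero.2 hz), map_one, one_apply_eq_self,
      map_zero] at h1
    exact eq_neg_of_add_eq_zero_left h1
  have hcn : ‖c‖ ≤ D * (K * ‖h‖) := by
    rw [hc, norm_neg]
    exact ContinuousLinearMap.le_of_opNorm_le_of_le _ le_rfl
      (hK h _ (right_mem_Icc.2 hab))
  have hfn : ∀ᵐ x ∂volume.restrict (Ioo P.left P.right),
      ‖f x‖ ≤ CU * (D * (K * ‖h‖) + K * ‖h‖) := by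
    filter_upwards [hfc, L2Interval.ae_mem_Ioo] with x hx hxm
    rw [hx]
    have hxm' := Ioo_subset_Icc_self hxm
    exact ContinuousLinearMap.le_of_opNorm_le_of_le _ (hCU x hxm')
      ((norm_add_le _ _).trans (add_le_add hcn (hK h x hxm')))
  refine (Lp.norm_le_of_ae_bound (by positivity) hfn).trans (le_of_eq ?_)
  rw [show CU * (D * (K * ‖h‖) + K * ‖h‖) = CU * (D * K + K) * ‖h‖ by ring, ← mul_assoc]

theorem exists_mem_graph_of_ne_zero (hz : P.F z ≠ 0) (h : L2Interval n P.left P.right) :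
    ∃ f : L2Interval n P.left P.right, (f, z • f + h) ∈ P.graph := by
  set w := pullbackIntegral P.node (P.generator z) (fun s => P.invCoeff s (h s)) P.right
  set M := P.S + P.T * P.transfer z
  obtain ⟨f, -, hf⟩ := P.exists_mem_graph z h
    (-(Matrix.toEuclideanCLM (𝕜 := ℂ) (M⁻¹ * (P.T * P.transfer z)) w)) (by
      rw [solution, boundary_eq, map_neg, ← mul_apply_eq_comp, ← map_mul,
        ← mul_assoc, Matrix.mul_nonsing_inv _ (isUnit_iff_ne_zero.2 hz), one_mul]
      exact neg_add_cancel _)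
  exact ⟨f, hf⟩

/-- The a priori estimate `exists_norm_le` serves twice: it makes `L - z` injective and bounds the
inverse. Surjectivity comes from solving the boundary condition for the initial value. -/
theorem exists_resolvent (hz : P.F z ≠ 0) :
    ∃ B : L2Interval n P.left P.right →L[ℂ] L2Interval n P.left P.right,
      (∀ h, ∃ hB : B h ∈ P.operator.domain, P.operator ⟨B h, hB⟩ - z • B h = h) ∧
      (∀ f : P.operator.domain, B (P.operator f - z • (f : L2Interval n P.left P.right)) = f) := by
  obtain ⟨C, -, hC⟩ := P.exists_norm_le z hz
  let Φ : P.operator.domain →ₗ[ℂ] L2Interval n P.left P.right :=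
    P.operator.toFun - z • P.operator.domain.subtype
  have hΦ : ∀ f, Φ f = P.operator f - z • (f : L2Interval n P.left P.right) := fun _ => rfl
  have hgraph : ∀ f : P.operator.domain,
      ((f : L2Interval n P.left P.right), P.operator f) ∈ P.graph := fun f =>
    P.operator_graph ▸ P.operator.mem_graph f
  have hnorm : ∀ f : P.operator.domain, ‖(f : L2Interval n P.left P.right)‖ ≤ C * ‖Φ f‖ := fun f =>
    hC _ _ (hgraph f)
  have hbij : Function.Bijective Φ := by
    constructor
    · rw [← LinearMap.ker_eq_bot, LinearMap.ker_eq_bot']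
      intro f hf
      have := hnorm f
      rw [hf, norm_zero, mul_zero] at this
      exact Subtype.ext (norm_le_zero_iff.1 this)
    · intro h
      obtain ⟨f, hf⟩ := P.exists_mem_graph_of_ne_zero z hz h
      rw [← operator_graph, LinearPMap.mem_graph_iff] at hf
      obtain ⟨y, hy1, hy2⟩ := hf
      refine ⟨y, ?_⟩
      rw [hΦ, hy2, hy1]
      exact add_sub_cancel_left _ _
  let e := LinearEquiv.ofBijective Φ hbij
  have he : ∀ h, Φ (e.symm h) = h := e.apply_symm_apply
  refine ⟨(P.operator.domain.subtype ∘ₗ e.symm.toLinearMap).mkContinuous C fun h => ?_,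
    fun h => ⟨(e.symm h).2, he h⟩, fun f => congrArg Subtype.val (e.symm_apply_apply f)⟩
  have := hnorm (e.symm h)
  rwa [he] at this

/-- A kernel vector `v` of `S + T U(β)` is the initial value. The solution is continuous, so if it
vanished almost everywhere it would vanish at the left end-point, where it equals `v`. -/
theorem exists_eigenfunction (hz : P.F z = 0) : ∃ f : L2Interval n P.left P.right,
    f ≠ 0 ∧ (f, z • f) ∈ P.graph := by
  obtain ⟨v, hv, hMv⟩ := Matrix.exists_mulVec_eq_zero_iff.2 hz
  have hw : pullbackIntegral P.node (P.generator z)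
      (fun s => P.invCoeff s ((0 : L2Interval n P.left P.right) s)) P.right = 0 := by
    have h0 := L2Interval.integral_congr (a := P.left) (b := P.right)
      (g := fun s => Ring.inverse (propagator P.node (P.generator z) s)
        (P.invCoeff s ((0 : L2Interval n P.left P.right) s))) (g' := fun _ => 0) (by
        filter_upwards [Lp.coeFn_zero (EuclideanSpace ℂ (Fin n)) 2
          (volume.restrict (Ioo P.left P.right))] with x hx
        rw [hx, Pi.zero_apply, map_zero, map_zero]) (right_mem_Icc.2 P.left_lt_right.le)
    exact h0.trans (by simp)
  obtain ⟨f, hf, hgraph⟩ := P.exists_mem_graph z 0 (WithLp.toLp 2 v) (by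
    rw [solution, boundary_eq, hw, map_zero, add_zero, Matrix.toEuclideanCLM_toLp, hMv]
    rfl)
  rw [add_zero] at hgraph
  refine ⟨f, fun hf0 => hv ?_, hgraph⟩
  have hprim := P.isPrimitiveOn_solution z 0 (WithLp.toLp 2 v)
  have hzero : EqOn (P.solution z (0 : L2Interval n P.left P.right) (WithLp.toLp 2 v))
      (fun _ => 0) (Icc P.left P.right) := by
    refine Measure.eqOn_Icc_of_ae_eq volume P.left_lt_right.ne ?_
      (hprim.continuousOn P.left_lt_right.le) continuousOn_const
    rw [← restrict_Ioo_eq_restrict_Icc]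
    filter_upwards [hf, Lp.coeFn_zero (EuclideanSpace ℂ (Fin n)) 2
      (volume.restrict (Ioo P.left P.right))] with x h1 h2
    rw [← h1, hf0, h2, Pi.zero_apply]
  have h0 := hzero (left_mem_Icc.2 P.left_lt_right.le)
  rw [solution_left] at h0
  exact congrArg WithLp.ofLp h0

/-- The spectrum of the operator is the set of the zeros of `F`. -/
theorem unboundedSpectrum_operator : P.operator.unboundedSpectrum = {z | P.F z = 0} := by
  ext z
  constructor
  · intro h
    by_contra hz
    exact h (P.exists_resolvent z hz)
  · rintro hz ⟨B, -, hB⟩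
    obtain ⟨f, hf, hgraph⟩ := P.exists_eigenfunction z hz
    rw [← operator_graph, LinearPMap.mem_graph_iff] at hgraph
    obtain ⟨y, hy1, hy2⟩ := hgraph
    -- A left inverse of `L - z` would have to send `0` to the eigenfunction.
    have := hB y
    rw [hy2, hy1, sub_self, map_zero] at this
    exact hf this.symm

end EllipticSystem

/-! ### Comparison of the two operators -/

theorem IsGenericExpansion.differentiable {F : ℂ → ℂ} {R : ℕ} {γ δ : Fin R → ℂ}
    (h : IsGenericExpansion F γ δ) : Differentiable ℂ F := by
  rw [funext h.expansion]
  fun_prop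

theorem IsGenericExpansion.exists_posLog_norm_le {F : ℂ → ℂ} {R : ℕ} {γ δ : Fin R → ℂ}
    (h : IsGenericExpansion F γ δ) : ∃ C : ℝ, ∀ z, Real.posLog ‖F z‖ ≤ C * (1 + ‖z‖) := by
  simp_rw [h.expansion]
  exact EntireFunction.exists_posLog_norm_sum_exp_le _ _

end

theorem theorem33 {n₁ m₁ R₁ n₂ m₂ R₂ : ℕ}
    (P₁ : EllipticSystem n₁ m₁) (P₂ : EllipticSystem n₂ m₂)
    (γ₁ δ₁ : Fin R₁ → ℂ) (γ₂ δ₂ : Fin R₂ → ℂ)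
    (h₁ : IsGenericExpansion P₁.F γ₁ δ₁) (h₂ : IsGenericExpansion P₂.F γ₂ δ₂)
    (simple₁ : ∀ z, P₁.F z = 0 → deriv P₁.F z ≠ 0)
    (simple₂ : ∀ z, P₂.F z = 0 → deriv P₂.F z ≠ 0)
    (hspec : P₁.operator.unboundedSpectrum = P₂.operator.unboundedSpectrum) :
    ∃ c h : ℂ, c ≠ 0 ∧
      (∀ z, P₂.F z = c * Complex.exp (h * z) * P₁.F z) ∧
      range γ₂ = (fun w => w + conj h) '' range γ₁ ∧
      convexHull ℝ (range γ₂) = (fun w => w + conj h) '' convexHull ℝ (range γ₁) := by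
  rw [P₁.unboundedSpectrum_operator, P₂.unboundedSpectrum_operator] at hspec
  obtain ⟨C₁, hC₁⟩ := h₁.exists_posLog_norm_le
  obtain ⟨C₂, hC₂⟩ := h₂.exists_posLog_norm_le
  obtain ⟨c, h, hc, hF⟩ := EntireFunction.eq_const_mul_exp_mul_of_zeros_eq h₁.differentiable
    h₂.differentiable hC₁ hC₂ simple₁ simple₂ (fun z => Set.ext_iff.1 hspec z)
  have hrange : range γ₂ = (fun w => w + conj h) '' range γ₁ := by
    have hconj : Function.Injective (conj : ℂ → ℂ) := (starRingEnd ℂ).injective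
    -- Both sides are the exponent sets of `P₂.F`: one from its own expansion, the other from that
    -- of `P₁.F` times `c * exp (h z)`.
    have hr : range (fun r => conj (γ₂ r)) = range (fun r => conj (γ₁ r) + h) := by
      refine EntireFunction.range_eq_of_sum_exp_eq (δ := δ₂) (ε := fun r => c * δ₁ r)
        (hconj.comp h₂.injective) ((add_left_injective h).comp (hconj.comp h₁.injective))
        h₂.ne_zero (fun r => mul_ne_zero hc (h₁.ne_zero r)) fun z => ?_
      rw [← h₂.expansion, hF, h₁.expansion, Finset.mul_sum]
      refine Finset.sum_congr rfl fun r _ => ?_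
      rw [mul_add, Complex.exp_add, mul_comm h z]
      ring
    rw [← range_comp]
    have himg := congrArg (image (conj : ℂ → ℂ)) hr
    rw [← range_comp, ← range_comp] at himg
    simpa [Function.comp_def] using himg
  refine ⟨c, h, hc, hF, hrange, ?_⟩
  rw [hrange]
  -- A translation is affine, hence commutes with taking convex hulls.
  exact ((AffineMap.id ℝ ℂ + AffineMap.const ℝ ℂ (conj h)).image_convexHull (range γ₁)).symm
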